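/- **Theorem 3.1.** Let $f\in C^\infty(\mathbb R^2)$ with $f(0,0)=0$, and let $U$ be an open neighbourhood of $(0,0)$ such that $f_{aa}(a,0)\neq 0$ for some $a$ with $(a,0)\in U$, and such that for all sufficiently small $\varepsilon>0$ the part in $U$ of the curve $\mathcal G_\varepsilon=\{b+\varepsilon f(a,b)=0\}$ is monotone. For $\varepsilon>0$ put $$S_0(a,b)=\begin{cases}0,& b>-\varepsilon f(a,b)\quad(\text{side }\mathcal G^-),\\ b+\varepsilon f(a,b),& b<-\varepsilon f(a,b)\quad(\text{side }\mathcal G^+),\end{cases}\qquad S_0=0\ \text{on}\ \mathcal G_\varepsilon,$$ and consider the pressureless gas with initial density $1$ and initial velocity $(u_0,v_0)=\nabla S_0$. *Shock surface.* Let $L\subset\mathbb R$ be open, let $l\mapsto (A(l),B(l))$, $l\in L$, be a regular $C^1$ parametrization of a part of $\mathcal G_\varepsilon$ which contains $\mathcal G_\varepsilon\cap U$, and let $T>0$ be a lower semicontinuous function on $L$. A shock surface $(x^s(t,l),y^s(t,l))$, $l\in L$, $0\le t<T(l)$, with feet of characteristics $(a_\pm,b_\pm)(t,l)$, consists of functions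 of class $C^1$ up to $t=0$, all equal to $(A(l),B(l))$ at $t=0$, such that for $0<t<T(l)$: $(a_\pm,b_\pm)\in\mathcal G^\pm$; $$x^s=a_\pm+t\,u_0(a_\pm,b_\pm),\qquad y^s=b_\pm+t\,v_0(a_\pm,b_\pm);$$ and the generalized Rankine–Hugoniot relations hold: $\widetilde P_t\ne 0$, $\ \partial_t x^s=\widetilde I_t/\widetilde P_t$, $\ \partial_t y^s=\widetilde J_t/\widetilde P_t$, where, with $D_\pm=(a_\pm)_\tau(b_\pm)_l-(b_\pm)_\tau(a_\pm)_l$ and with $u_0^\pm,v_0^\pm$ the values of $u_0,v_0$ at $(a_\pm,b_\pm)$, $$\widetilde P_t=\int_0^t (D_+-D_-)\,d\tau,\quad \widetilde I_t=\int_0^t (u_0^+D_+-u_0^-D_-)\,d\tau,\quad \widetilde J_t=\int_0^t (v_0^+D_+-v_0^-D_-)\,d\tau .$$ *Variational surface.* Let $F(a,b;t,x,y)=S_0(a,b)+\frac{(x-a)^2}{2t}+\frac{(y-b)^2}{2t}$. For $K\subset\mathbb R^2$ let $\mathcal F_K$ be the set of $(t,x,y)$, $t>0$, for which there are solutions $(a_\pm,b_\pm)\in\mathcal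 G^\pm\cap K$ of $F_a=F_b=0$ with $F(a_+,b_+;t,x,y)=F(a_-,b_-;t,x,y)$. Let $\mathcal H$ be the set of singular points of the Hopf–Lax representation, i.e. of $(t,x,y)$, $t>0$, for which the global minimum of $F(\cdot,\cdot;t,x,y)$ over $\mathbb R^2$ is attained at more than one point. Then there is $\varepsilon_0>0$ such that for every $0<\varepsilon<\varepsilon_0$ every shock surface as above differs from the variational surface. Precisely, there is $l_0\in L$ with $(A(l_0),B(l_0))\in U$ such that the following hold. 1. For every bounded $K\subset\mathbb R^2$ there are points $(t,l)$ with $t>0$, $l\in L$, $t<T(l)$, arbitrarily close to $(0,l_0)$, for which $(t,x^s(t,l),y^s(t,l))\notin\mathcal F_K$. 2. There are points $(t,l)$ with $t>0$, $l\in L$, $t<T(l)$, arbitrarily close to $(0,l_0)$, for which $(t,x^s(t,l),y^s(t,l))\notin\mathcal H$. In particular the 1-D variational principle fails in 2-D. -/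

import Mathlib

open Set Filter Topology
open scoped ContDiff

noncomputable section

namespace PressurelessGas

/-- The curve `b + ε f(a,b) = 0` in the plane of initial positions. -/
def initialCurve (f : ℝ → ℝ → ℝ) (ε : ℝ) : Set (ℝ × ℝ) :=
  {p | p.2 + ε * f p.1 p.2 = 0}

/-- The `+` side of the curve, where `b + ε f(a,b) < 0` (moving gas). -/
def plusSide (f : ℝ → ℝ → ℝ) (ε : ℝ) : Set (ℝ × ℝ) :=
  {p | p.2 + ε * f p.1 p.2 < 0}

/-- The `-` side of the curve, where `b + ε f(a,b) > 0` (gas at rest). -/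
def minusSide (f : ℝ → ℝ → ℝ) (ε : ℝ) : Set (ℝ × ℝ) :=
  {p | 0 < p.2 + ε * f p.1 p.2}

open Classical in
/-- The potential of the initial velocity: `0` for `b > -ε f(a,b)` and `b + ε f(a,b)` for
`b < -ε f(a,b)`; on the curve both expressions vanish. -/
def potential (f : ℝ → ℝ → ℝ) (ε : ℝ) (a b : ℝ) : ℝ :=
  if b < -(ε * f a b) then b + ε * f a b else 0

/-- First component of the initial velocity `∇ S₀`. -/
def velU (S₀ : ℝ → ℝ → ℝ) (a b : ℝ) : ℝ := deriv (fun s => S₀ s b) a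

/-- Second component of the initial velocity `∇ S₀`. -/
def velV (S₀ : ℝ → ℝ → ℝ) (a b : ℝ) : ℝ := deriv (fun s => S₀ a s) b

/-- A plane set is a (part of a) monotone curve: along it `b` is a non-decreasing, or a
non-increasing, function of `a` (vertical pieces allowed). -/
def IsMonotoneCurve (C : Set (ℝ × ℝ)) : Prop :=
  (∀ p ∈ C, ∀ q ∈ C, 0 ≤ (p.1 - q.1) * (p.2 - q.2)) ∨
  (∀ p ∈ C, ∀ q ∈ C, (p.1 - q.1) * (p.2 - q.2) ≤ 0)

/-! ### The shock surface -/

/-- `a_τ b_l - b_τ a_l`, for functions `a`, `b` of `(τ, l)`. -/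
def jacobian (a b : ℝ → ℝ → ℝ) (τ l : ℝ) : ℝ :=
  deriv (fun s => a s l) τ * deriv (fun m => b τ m) l -
    deriv (fun s => b s l) τ * deriv (fun m => a τ m) l

/-- The amount of a quantity of initial density `g` collected by the front up to time `t`
(per unit of `l`):
`∫₀ᵗ [g(a₊,b₊) ((a₊)_τ (b₊)_l - (b₊)_τ (a₊)_l) - g(a₋,b₋) ((a₋)_τ (b₋)_l - (b₋)_τ (a₋)_l)] dτ`. -/
def collected (g : ℝ → ℝ → ℝ) (ap bp am bm : ℝ → ℝ → ℝ) (t l : ℝ) : ℝ :=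
  ∫ τ in (0 : ℝ)..t,
    (g (ap τ l) (bp τ l) * jacobian ap bp τ l - g (am τ l) (bm τ l) * jacobian am bm τ l)

/-- The parameter domain `{(t,l) : l ∈ L, 0 ≤ t < T(l)}` of a front. -/
def frontDomain (L : Set ℝ) (T : ℝ → ℝ) : Set (ℝ × ℝ) :=
  {p | p.2 ∈ L ∧ 0 ≤ p.1 ∧ p.1 < T p.2}

/-- `(t,l) ↦ (x(t,l), y(t,l))` is a shock surface for the initial density `ρ₀` and the potential
initial velocity `∇ S₀`. It issues from the curve `l ↦ (A(l), B(l))`, separating the sides `Gp`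
and `Gm`, and it satisfies the generalized Rankine-Hugoniot relations. The functions `ap, bp` and
`am, bm` of `(t,l)` are the initial positions of the two characteristics which arrive, from the
side `Gp` and from the side `Gm`, at the point `(x(t,l), y(t,l))` at time `t`. -/
structure IsShockFront (ρ₀ S₀ : ℝ → ℝ → ℝ) (Gp Gm : Set (ℝ × ℝ)) (L : Set ℝ) (A B T : ℝ → ℝ)
    (x y ap bp am bm : ℝ → ℝ → ℝ) : Prop where
  isOpen_param : IsOpen L
  contDiff_A : ContDiffOn ℝ 1 A L
  contDiff_B : ContDiffOn ℝ 1 B L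
  regular : ∀ l ∈ L, deriv A l ^ 2 + deriv B l ^ 2 ≠ 0
  lifetime_pos : ∀ l ∈ L, 0 < T l
  /-- so that the parameter domain is open, up to its boundary part `t = 0` -/
  lifetime_lsc : LowerSemicontinuousOn T L
  contDiff_x : ContDiffOn ℝ 1 (Function.uncurry x) (frontDomain L T)
  contDiff_y : ContDiffOn ℝ 1 (Function.uncurry y) (frontDomain L T)
  contDiff_ap : ContDiffOn ℝ 1 (Function.uncurry ap) (frontDomain L T)
  contDiff_bp : ContDiffOn ℝ 1 (Function.uncurry bp) (frontDomain L T)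
  contDiff_am : ContDiffOn ℝ 1 (Function.uncurry am) (frontDomain L T)
  contDiff_bm : ContDiffOn ℝ 1 (Function.uncurry bm) (frontDomain L T)
  /-- the front, and the feet of the characteristics, start on the curve -/
  initial : ∀ l ∈ L, x 0 l = A l ∧ y 0 l = B l ∧ ap 0 l = A l ∧ bp 0 l = B l ∧
    am 0 l = A l ∧ bm 0 l = B l
  mem_plus : ∀ l ∈ L, ∀ t, 0 < t → t < T l → (ap t l, bp t l) ∈ Gp
  mem_minus : ∀ l ∈ L, ∀ t, 0 < t → t < T l → (am t l, bm t l) ∈ Gm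
  characteristic_plus : ∀ l ∈ L, ∀ t, 0 < t → t < T l →
    x t l = ap t l + t * velU S₀ (ap t l) (bp t l) ∧
    y t l = bp t l + t * velV S₀ (ap t l) (bp t l)
  characteristic_minus : ∀ l ∈ L, ∀ t, 0 < t → t < T l →
    x t l = am t l + t * velU S₀ (am t l) (bm t l) ∧
    y t l = bm t l + t * velV S₀ (am t l) (bm t l)
  /-- the generalized Rankine-Hugoniot relations: the velocity of the front is the quotient of the
  collected momentum by the collected mass -/
  rankine_hugoniot : ∀ l ∈ L, ∀ t, 0 < t → t < T l →
    collected ρ₀ ap bp am bm t l ≠ 0 ∧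
    deriv (fun s => x s l) t =
      collected (fun a b => ρ₀ a b * velU S₀ a b) ap bp am bm t l /
        collected ρ₀ ap bp am bm t l ∧
    deriv (fun s => y s l) t =
      collected (fun a b => ρ₀ a b * velV S₀ a b) ap bp am bm t l /
        collected ρ₀ ap bp am bm t l

/-! ### The singular surface of the variational representation -/

/-- The function `F = S₀(a,b) + (x-a)²/(2t) + (y-b)²/(2t)`, whose minimum over `(a,b)` is the
Hopf-Lax potential at `(t,x,y)`. -/
def hopfLaxFun (S₀ : ℝ → ℝ → ℝ) (a b t x y : ℝ) : ℝ :=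
  S₀ a b + (x - a) ^ 2 / (2 * t) + (y - b) ^ 2 / (2 * t)

/-- `F_a = F_b = 0`. -/
def IsCriticalPt (S₀ : ℝ → ℝ → ℝ) (a b t x y : ℝ) : Prop :=
  deriv (fun s => hopfLaxFun S₀ s b t x y) a = 0 ∧
  deriv (fun s => hopfLaxFun S₀ a s t x y) b = 0

/-- The points `(t,x,y)`, `t > 0`, with `F(a₊,b₊;t,x,y) = F(a₋,b₋;t,x,y)`, where `(a₊,b₊)` and
`(a₋,b₋)` are solutions of `F_a = F_b = 0` on the sides `Gp` and `Gm`, taken in the region `K`. -/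
def variationalSurface (S₀ : ℝ → ℝ → ℝ) (Gp Gm K : Set (ℝ × ℝ)) : Set (ℝ × ℝ × ℝ) :=
  {z | 0 < z.1 ∧ ∃ ap bp am bm : ℝ,
    (ap, bp) ∈ Gp ∩ K ∧ (am, bm) ∈ Gm ∩ K ∧
    IsCriticalPt S₀ ap bp z.1 z.2.1 z.2.2 ∧ IsCriticalPt S₀ am bm z.1 z.2.1 z.2.2 ∧
    hopfLaxFun S₀ ap bp z.1 z.2.1 z.2.2 = hopfLaxFun S₀ am bm z.1 z.2.1 z.2.2}

/-- The singular points of the Hopf-Lax representation: the points `(t,x,y)`, `t > 0`, for which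
the global minimum of `F` over all `(a,b)` is attained at more than one point. -/
def hopfLaxSingularSet (S₀ : ℝ → ℝ → ℝ) : Set (ℝ × ℝ × ℝ) :=
  {z | 0 < z.1 ∧ ∃ p q : ℝ × ℝ, p ≠ q ∧
    IsMinOn (fun r : ℝ × ℝ => hopfLaxFun S₀ r.1 r.2 z.1 z.2.1 z.2.2) univ p ∧
    IsMinOn (fun r : ℝ × ℝ => hopfLaxFun S₀ r.1 r.2 z.1 z.2.1 z.2.2) univ q}

end PressurelessGas

end

namespace PressurelessGas

/-! ### Calculus on the parameter domain of a front -/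

section Domain

variable {L : Set ℝ} {T : ℝ → ℝ}

/-! Write `G = b + ε f`, `w = ∇G` at the foot of the moving characteristic, `X = (x, y)` for the
front. The gas on the minus side is at rest, so its foot is `X` itself and its value of `F` is `0`.
Equality of the two values of `F` thus reads `G + (t/2)|w|² = 0` at the moving foot. If it held for
all small `t > 0` and all `l` near `l₀`, differentiation in `l` and `t` would give `w · X_l = 0` and
`w · X_t = |w|²/2`.

With the Rankine–Hugoniot relations the second identity becomes `w · (I, J) = P |w|²/2`.
Differentiating once more in `t`, dividing by `t` and letting `t → 0`, the terms containing `w_t`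
cancel and what remains is `w × w_l = 0`: the direction of `∇G` is stationary along the initial
curve, which is therefore not curved at `l₀` (`cross_eq_zero_of_tangency`,
`IsShockFront.not_eventually_potential_continuous`). But the curvature of `G = 0` is `ε f_aa(a,0)`
to leading order, so for small `ε` a curved point exists in `U` (`exists_curved_point`).

For the Hopf–Lax set, minimizers at small times stay in a bounded region, where moving
characteristics do not meet. Of two minimizers one is then the resting point `X` and the other lies
on the plus side, which reduces this case to the variational surface
(`exists_isBounded_hopfLaxSingularSet_imp`). -/

lemma frontDomain_mem_nhdsWithin (hL : IsOpen L) (hT : LowerSemicontinuousOn T L)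
    {p : ℝ × ℝ} (hp : p ∈ frontDomain L T) :
    frontDomain L T ∈ 𝓝[Ici (0 : ℝ) ×ˢ univ] p := by
  obtain ⟨hpL, hp0, hpT⟩ := hp
  -- A time strictly between `p.1` and `T p.2` separates the two conditions: nearby points have time
  -- below `s`, and lower semicontinuity keeps `T` above `s`.
  obtain ⟨s, hs1, hs2⟩ := exists_between hpT
  have h1 : ∀ᶠ q : ℝ × ℝ in 𝓝 p, q.1 < s := continuous_fst.continuousAt.eventually_lt_const hs1
  have hLp : ∀ᶠ l in 𝓝 p.2, l ∈ L := hL.mem_nhds hpL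
  have h2 : ∀ᶠ l in 𝓝 p.2, s < T l := by
    have := hT p.2 hpL s hs2
    rwa [hL.nhdsWithin_eq hpL] at this
  have h3 := continuous_snd.continuousAt.eventually (hLp.and h2)
  filter_upwards [nhdsWithin_le_nhds h1, nhdsWithin_le_nhds h3, self_mem_nhdsWithin]
    with q hq1 hq2 hq3
  exact ⟨hq2.1, hq3.1, hq1.trans hq2.2⟩

lemma nhdsWithin_frontDomain (hL : IsOpen L) (hT : LowerSemicontinuousOn T L)
    {p : ℝ × ℝ} (hp : p ∈ frontDomain L T) :
    𝓝[frontDomain L T] p = 𝓝[Ici (0 : ℝ) ×ˢ univ] p :=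
  le_antisymm (nhdsWithin_mono _ fun _ hq => ⟨hq.2.1, trivial⟩)
    (nhdsWithin_le_iff.2 (frontDomain_mem_nhdsWithin hL hT hp))

lemma frontDomain_mem_nhds (hL : IsOpen L) (hT : LowerSemicontinuousOn T L)
    {p : ℝ × ℝ} (hp : p ∈ frontDomain L T) (h0 : 0 < p.1) : frontDomain L T ∈ 𝓝 p := by
  have := frontDomain_mem_nhdsWithin hL hT hp
  rwa [nhdsWithin_eq_nhds.2 (prod_mem_nhds (Ici_mem_nhds h0) univ_mem)] at this

/-- Near each of its points the domain coincides with the closed half-plane `t ≥ 0`. This makes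
`fderivWithin` continuous up to `t = 0`. -/
lemma uniqueDiffOn_frontDomain (hL : IsOpen L) (hT : LowerSemicontinuousOn T L) :
    UniqueDiffOn ℝ (frontDomain L T) := fun p hp =>
  (((uniqueDiffOn_Ici (0 : ℝ)).prod uniqueDiffOn_univ) p ⟨hp.2.1, trivial⟩).mono_nhds
    (nhdsWithin_frontDomain hL hT hp).ge

lemma eventually_mem_frontDomain (hL : IsOpen L) (hT : LowerSemicontinuousOn T L)
    {l : ℝ} (hl : l ∈ L) (hl0 : 0 < T l) :
    ∀ᶠ p in 𝓝[>] (0 : ℝ) ×ˢ 𝓝 l, p ∈ frontDomain L T ∧ 0 < p.1 := by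
  have h : frontDomain L T ∈ 𝓝[Ici (0 : ℝ) ×ˢ univ] (0, l) :=
    frontDomain_mem_nhdsWithin hL hT ⟨hl, le_rfl, hl0⟩
  rw [nhdsWithin_prod_eq, nhdsWithin_univ] at h
  exact Eventually.and ((Filter.prod_mono_left _ (nhdsWithin_mono _ Ioi_subset_Ici_self)) h)
    (tendsto_fst.eventually self_mem_nhdsWithin)

lemma tendsto_prod_nhdsWithin_frontDomain (hL : IsOpen L) (hT : LowerSemicontinuousOn T L)
    {l : ℝ} (hl : l ∈ L) (hl0 : 0 < T l) :
    𝓝[>] (0 : ℝ) ×ˢ 𝓝 l ≤ 𝓝[frontDomain L T] (0, l) := by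
  rw [nhdsWithin_frontDomain hL hT ⟨hl, le_rfl, hl0⟩, nhdsWithin_prod_eq, nhdsWithin_univ]
  exact Filter.prod_mono_left _ (nhdsWithin_mono _ Ioi_subset_Ici_self)

/-- A function of class `C¹` up to `t = 0` has partial derivatives which are continuous up to
`t = 0`. -/
lemma exists_partials (hL : IsOpen L) (hT : LowerSemicontinuousOn T L) (hT0 : ∀ l ∈ L, 0 < T l)
    {φ : ℝ → ℝ → ℝ} (hφ : ContDiffOn ℝ 1 (Function.uncurry φ) (frontDomain L T)) :
    ∃ φt φl : ℝ × ℝ → ℝ, ContinuousOn φt (frontDomain L T) ∧ ContinuousOn φl (frontDomain L T) ∧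
      (∀ p ∈ frontDomain L T, 0 < p.1 → HasDerivAt (fun s => φ s p.2) (φt p) p.1 ∧
        HasDerivAt (fun m => φ p.1 m) (φl p) p.2) ∧
      ∀ l ∈ L, HasDerivAt (fun m => φ 0 m) (φl (0, l)) l := by
  have hc := hφ.continuousOn_fderivWithin (uniqueDiffOn_frontDomain hL hT) le_rfl
  have hd : ∀ p ∈ frontDomain L T, HasFDerivWithinAt (Function.uncurry φ)
      (fderivWithin ℝ (Function.uncurry φ) (frontDomain L T) p) (frontDomain L T) p :=
    fun p hp => (hφ.differentiableOn one_ne_zero p hp).hasFDerivWithinAt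
  have key : ∀ p ∈ frontDomain L T, ∀ᶠ m in 𝓝 p.2, (p.1, m) ∈ frontDomain L T := by
    intro p hp
    have h := frontDomain_mem_nhdsWithin hL hT hp
    have : Tendsto (fun m : ℝ => (p.1, m)) (𝓝 p.2) (𝓝[Ici (0 : ℝ) ×ˢ univ] p) := by
      refine tendsto_nhdsWithin_iff.2 ⟨?_, Eventually.of_forall fun m => ⟨hp.2.1, trivial⟩⟩
      exact (Continuous.prodMk_right p.1).tendsto p.2
    exact this h
  have hl : ∀ p ∈ frontDomain L T, HasDerivAt (fun m => φ p.1 m)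
      (fderivWithin ℝ (Function.uncurry φ) (frontDomain L T) p (0, 1)) p.2 := by
    intro p hp
    exact (hd p hp).comp_hasDerivAt_of_eq p.2
      ((hasDerivAt_const p.2 p.1).prodMk (hasDerivAt_id p.2)) (key p hp) rfl
  refine ⟨fun p => fderivWithin ℝ (Function.uncurry φ) (frontDomain L T) p (1, 0),
    fun p => fderivWithin ℝ (Function.uncurry φ) (frontDomain L T) p (0, 1),
    hc.clm_apply continuousOn_const, hc.clm_apply continuousOn_const, fun p hp h0 => ⟨?_, hl p hp⟩,
    fun l h => hl (0, l) ⟨h, le_rfl, hT0 l h⟩⟩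
  exact ((hd p hp).hasFDerivAt (frontDomain_mem_nhds hL hT hp h0)).comp_hasDerivAt_of_eq p.1
      ((hasDerivAt_id p.1).prodMk (hasDerivAt_const p.1 p.2)) rfl

end Domain

/-! ### Primitives of functions continuous up to the initial time -/

lemma hasDerivAt_integral_of_continuousOn_Ico {h : ℝ → ℝ} {c : ℝ}
    (hh : ContinuousOn h (Ico 0 c)) {t : ℝ} (ht : t ∈ Ioo 0 c) :
    HasDerivAt (fun s => ∫ τ in (0 : ℝ)..s, h τ) (h t) t := by
  have hI : Ico 0 c ∈ 𝓝 t := Ico_mem_nhds ht.1 ht.2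
  refine intervalIntegral.integral_hasDerivAt_right ?_ ?_ (hh.continuousAt hI)
  · refine ContinuousOn.intervalIntegrable ?_
    rw [uIcc_of_le ht.1.le]
    exact hh.mono fun s hs => ⟨hs.1, hs.2.trans_lt ht.2⟩
  · exact ⟨_, hI, hh.aestronglyMeasurable measurableSet_Ico⟩

lemma tendsto_integral_div_of_continuousOn_Ico {h : ℝ → ℝ} {c : ℝ} (hc : 0 < c)
    (hh : ContinuousOn h (Ico 0 c)) :
    Tendsto (fun s => (∫ τ in (0 : ℝ)..s, h τ) / s) (𝓝[>] 0) (𝓝 (h 0)) := by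
  have h1 : HasDerivWithinAt (fun s => ∫ τ in (0 : ℝ)..s, h τ) (h 0) (Ici 0) 0 := by
    have hI : Ico 0 c ∈ 𝓝[Ici 0] (0 : ℝ) := Ico_mem_nhdsGE hc
    refine intervalIntegral.integral_hasDerivWithinAt_right (t := Ioi 0) (by simp) ?_ ?_
    · exact ⟨_, Ioo_mem_nhdsGT hc,
        (hh.mono Ioo_subset_Ico_self).aestronglyMeasurable measurableSet_Ioo⟩
    · exact ((hh 0 ⟨le_rfl, hc⟩).mono_of_mem_nhdsWithin hI).mono Ioi_subset_Ici_self
  have h2 := hasDerivWithinAt_iff_tendsto_slope.1 h1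
  have : Ici (0 : ℝ) \ {0} = Ioi 0 := by simp
  rw [this] at h2
  refine h2.congr fun s => ?_
  simp [slope_def_field]

/-! ### The compatibility condition at the initial time -/

/-- `(X, Y)` is a front with characteristics of velocity `w` on one side and gas at rest on the
other side; if it is tangent to the jump of the potential, then `w` keeps its direction along the
initial curve. -/
lemma cross_eq_zero_of_tangency
    {w₁ w₂ w₁t w₂t w₁l w₂l xt yt xl yl at' bt al bl P I J : ℝ → ℝ}
    (cw₁ : Tendsto w₁ (𝓝[>] 0) (𝓝 (w₁ 0))) (cw₂ : Tendsto w₂ (𝓝[>] 0) (𝓝 (w₂ 0)))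
    (cw₁t : Tendsto w₁t (𝓝[>] 0) (𝓝 (w₁t 0))) (cw₂t : Tendsto w₂t (𝓝[>] 0) (𝓝 (w₂t 0)))
    (cw₁l : Tendsto w₁l (𝓝[>] 0) (𝓝 (w₁l 0))) (cw₂l : Tendsto w₂l (𝓝[>] 0) (𝓝 (w₂l 0)))
    (cxt : Tendsto xt (𝓝[>] 0) (𝓝 (xt 0))) (cyt : Tendsto yt (𝓝[>] 0) (𝓝 (yt 0)))
    (cxl : Tendsto xl (𝓝[>] 0) (𝓝 (xl 0))) (cyl : Tendsto yl (𝓝[>] 0) (𝓝 (yl 0)))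
    (cat : Tendsto at' (𝓝[>] 0) (𝓝 (at' 0))) (cbt : Tendsto bt (𝓝[>] 0) (𝓝 (bt 0)))
    (cal : Tendsto al (𝓝[>] 0) (𝓝 (al 0))) (cbl : Tendsto bl (𝓝[>] 0) (𝓝 (bl 0)))
    (cP : Tendsto (fun t => P t / t) (𝓝[>] 0)
      (𝓝 ((at' 0 * bl 0 - bt 0 * al 0) - (xt 0 * yl 0 - yt 0 * xl 0))))
    (cI : Tendsto (fun t => I t / t) (𝓝[>] 0) (𝓝 (w₁ 0 * (at' 0 * bl 0 - bt 0 * al 0))))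
    (cJ : Tendsto (fun t => J t / t) (𝓝[>] 0) (𝓝 (w₂ 0 * (at' 0 * bl 0 - bt 0 * al 0))))
    (hw₁ : ∀ᶠ t in 𝓝[>] (0 : ℝ), HasDerivAt w₁ (w₁t t) t)
    (hw₂ : ∀ᶠ t in 𝓝[>] (0 : ℝ), HasDerivAt w₂ (w₂t t) t)
    (hP : ∀ᶠ t in 𝓝[>] (0 : ℝ), HasDerivAt P
      ((at' t * bl t - bt t * al t) - (xt t * yl t - yt t * xl t)) t)
    (hI : ∀ᶠ t in 𝓝[>] (0 : ℝ), HasDerivAt I (w₁ t * (at' t * bl t - bt t * al t)) t)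
    (hJ : ∀ᶠ t in 𝓝[>] (0 : ℝ), HasDerivAt J (w₂ t * (at' t * bl t - bt t * al t)) t)
    (hxt : ∀ᶠ t in 𝓝[>] (0 : ℝ), xt t = at' t + w₁ t + t * w₁t t)
    (hyt : ∀ᶠ t in 𝓝[>] (0 : ℝ), yt t = bt t + w₂ t + t * w₂t t)
    (hxl : ∀ᶠ t in 𝓝[>] (0 : ℝ), xl t = al t + t * w₁l t)
    (hyl : ∀ᶠ t in 𝓝[>] (0 : ℝ), yl t = bl t + t * w₂l t)
    (hl : ∀ᶠ t in 𝓝[>] (0 : ℝ), w₁ t * xl t + w₂ t * yl t = 0)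
    (ht : ∀ᶠ t in 𝓝[>] (0 : ℝ), w₁ t * xt t + w₂ t * yt t = (w₁ t ^ 2 + w₂ t ^ 2) / 2)
    (hRH : ∀ᶠ t in 𝓝[>] (0 : ℝ), P t ≠ 0 ∧ xt t = I t / P t ∧ yt t = J t / P t)
    (hw : w₁ 0 ^ 2 + w₂ 0 ^ 2 ≠ 0) (hκ : w₁ 0 * yl 0 - w₂ 0 * xl 0 ≠ 0) :
    w₁ 0 * w₂l 0 - w₂ 0 * w₁l 0 = 0 := by
  have cid : Tendsto (fun t : ℝ => t) (𝓝[>] 0) (𝓝 0) := nhdsWithin_le_nhds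
  have hmom : ∀ᶠ t in 𝓝[>] (0 : ℝ),
      w₁ t * I t + w₂ t * J t = P t * (w₁ t ^ 2 + w₂ t ^ 2) / 2 := by
    filter_upwards [ht, hRH] with t h1 ⟨h2, h3, h4⟩
    rw [eq_div_iff h2] at h3 h4
    rw [← h3, ← h4]
    linear_combination P t * h1
  have hmom' := eventually_eventually_nhdsWithin.2 hmom
  -- the time derivative of the momentum relation
  have hder : ∀ᶠ t in 𝓝[>] (0 : ℝ),
      w₁t t * I t + w₁ t * (w₁ t * (at' t * bl t - bt t * al t)) +
        (w₂t t * J t + w₂ t * (w₂ t * (at' t * bl t - bt t * al t))) =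
      (((at' t * bl t - bt t * al t) - (xt t * yl t - yt t * xl t)) * (w₁ t ^ 2 + w₂ t ^ 2) +
        P t * (2 * w₁ t * w₁t t + 2 * w₂ t * w₂t t)) / 2 := by
    filter_upwards [hmom', hw₁, hw₂, hP, hI, hJ, self_mem_nhdsWithin] with t h h1 h2 h3 h4 h5 h6
    rw [nhdsWithin_eq_nhds.2 (Ioi_mem_nhds h6)] at h
    have e1 := (h1.fun_mul h4).fun_add (h2.fun_mul h5)
    have e2 := (h3.fun_mul ((h1.fun_pow 2).fun_add (h2.fun_pow 2))).div_const 2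
    have e3 := e1.congr_of_eventuallyEq (EventuallyEq.symm h)
    rw [e3.unique e2]
    push_cast
    ring
  -- Both `m1` and `m2` use `|w|² (p × q) = (w·p)(w × q) - (w × p)(w·q)` with `q = X_l`, where `w·q
  -- = 0`. The terms of order zero in `|w|² (D₊ + D₋)` cancel, so the differentiated momentum
  -- relation can be divided by `t`.
  have hfin : ∀ᶠ t in 𝓝[>] (0 : ℝ),
      -(w₁ t * w₁t t + w₂ t * w₂t t) * (w₁ t * yl t - w₂ t * xl t) -
        (w₁ t ^ 2 + w₂ t ^ 2) * (at' t * w₂l t - bt t * w₁l t) =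
      2 * (P t / t) * (w₁ t * w₁t t + w₂ t * w₂t t) -
        2 * (w₁t t * (I t / t) + w₂t t * (J t / t)) := by
    filter_upwards [hder, hxt, hyt, hxl, hyl, hl, ht, self_mem_nhdsWithin]
      with t h h1 h2 h3 h4 h5 h6 h7
    have h7' : t ≠ 0 := ne_of_gt h7
    have m1 : (w₁ t ^ 2 + w₂ t ^ 2) * (xt t * yl t - yt t * xl t) =
        (w₁ t ^ 2 + w₂ t ^ 2) / 2 * (w₁ t * yl t - w₂ t * xl t) := by
      linear_combination (w₁ t * yl t - w₂ t * xl t) * h6 + (w₂ t * xt t - w₁ t * yt t) * h5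
    have m2 : (w₁ t ^ 2 + w₂ t ^ 2) * (at' t * yl t - bt t * xl t) =
        (-(w₁ t ^ 2 + w₂ t ^ 2) / 2 - t * (w₁ t * w₁t t + w₂ t * w₂t t)) *
          (w₁ t * yl t - w₂ t * xl t) := by
      have a1 : at' t = xt t - w₁ t - t * w₁t t := by linarith
      have a2 : bt t = yt t - w₂ t - t * w₂t t := by linarith
      rw [a1, a2]
      linear_combination (w₁ t * yl t - w₂ t * xl t) * h6 +
        (w₂ t * (xt t - w₁ t - t * w₁t t) - w₁ t * (yt t - w₂ t - t * w₂t t)) * h5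
    field_simp
    have a3 : al t = xl t - t * w₁l t := by linarith
    have a4 : bl t = yl t - t * w₂l t := by linarith
    rw [a3, a4] at h
    linear_combination 2 * h - m1 - m2
  have hlim := tendsto_nhds_unique_of_eventuallyEq
    (((((cw₁.mul cw₁t).add (cw₂.mul cw₂t)).neg).mul ((cw₁.mul cyl).sub (cw₂.mul cxl))).sub
      (((cw₁.pow 2).add (cw₂.pow 2)).mul ((cat.mul cw₂l).sub (cbt.mul cw₁l))))
    (((cP.const_mul 2).mul ((cw₁.mul cw₁t).add (cw₂.mul cw₂t))).sub
      (((cw₁t.mul cI).add (cw₂t.mul cJ)).const_mul 2)) hfin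
  have x0 : xt 0 = at' 0 + w₁ 0 + 0 * w₁t 0 := tendsto_nhds_unique_of_eventuallyEq cxt
    ((cat.add cw₁).add (cid.mul cw₁t)) hxt
  have y0 : yt 0 = bt 0 + w₂ 0 + 0 * w₂t 0 := tendsto_nhds_unique_of_eventuallyEq cyt
    ((cbt.add cw₂).add (cid.mul cw₂t)) hyt
  have xl0 : xl 0 = al 0 + 0 * w₁l 0 := tendsto_nhds_unique_of_eventuallyEq cxl
    (cal.add (cid.mul cw₁l)) hxl
  have yl0 : yl 0 = bl 0 + 0 * w₂l 0 := tendsto_nhds_unique_of_eventuallyEq cyl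
    (cbl.add (cid.mul cw₂l)) hyl
  have l0 : w₁ 0 * xl 0 + w₂ 0 * yl 0 = 0 := tendsto_nhds_unique_of_eventuallyEq
    ((cw₁.mul cxl).add (cw₂.mul cyl)) tendsto_const_nhds hl
  have t0 : w₁ 0 * xt 0 + w₂ 0 * yt 0 = (w₁ 0 ^ 2 + w₂ 0 ^ 2) / 2 :=
    tendsto_nhds_unique_of_eventuallyEq
    ((cw₁.mul cxt).add (cw₂.mul cyt)) (((cw₁.pow 2).add (cw₂.pow 2)).div_const 2) ht
  -- The limit is taken in the product form `X_t (P/t) = (I, J)/t`. With `r2` this forces `X_t =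
  -- w/2` at `t = 0`, hence foot velocity `-w/2`.
  have r1 := tendsto_nhds_unique_of_eventuallyEq (cxt.mul cP) cI (by
    filter_upwards [hRH] with t ⟨h2, h3, h4⟩
    rw [h3]; field_simp)
  have r2 := tendsto_nhds_unique_of_eventuallyEq (cyt.mul cP) cJ (by
    filter_upwards [hRH] with t ⟨h2, h3, h4⟩
    rw [h4]; field_simp)
  simp only [zero_mul, add_zero] at x0 y0 xl0 yl0
  have a1 : at' 0 = xt 0 - w₁ 0 := by linarith
  have a2 : bt 0 = yt 0 - w₂ 0 := by linarith
  rw [← xl0, ← yl0] at r1 r2 hlim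
  have dm : xt 0 * yl 0 - yt 0 * xl 0 = (w₁ 0 * yl 0 - w₂ 0 * xl 0) / 2 := by
    apply mul_left_cancel₀ hw
    linear_combination (w₁ 0 * yl 0 - w₂ 0 * xl 0) * t0 + (w₂ 0 * xt 0 - w₁ 0 * yt 0) * l0
  have dp : at' 0 * yl 0 - bt 0 * xl 0 = -(w₁ 0 * yl 0 - w₂ 0 * xl 0) / 2 := by
    rw [a1, a2]; linear_combination dm
  rw [dm, dp] at r1 r2 hlim
  have xh : xt 0 = w₁ 0 / 2 := by
    apply mul_right_cancel₀ hκ; linear_combination -r1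
  have yh : yt 0 = w₂ 0 / 2 := by
    apply mul_right_cancel₀ hκ; linear_combination -r2
  rw [a1, a2, xh, yh] at hlim
  apply mul_left_cancel₀ hw
  linear_combination 2 * hlim

/-! ### The potential on the two sides of the curve -/

/-- The partial derivative in the first variable. -/
noncomputable def partialFst (h : ℝ × ℝ → ℝ) (p : ℝ × ℝ) : ℝ := fderiv ℝ h p (1, 0)

/-- The partial derivative in the second variable. -/
noncomputable def partialSnd (h : ℝ × ℝ → ℝ) (p : ℝ × ℝ) : ℝ := fderiv ℝ h p (0, 1)

lemma contDiff_partialFst {h : ℝ × ℝ → ℝ} (hh : ContDiff ℝ ∞ h) :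
    ContDiff ℝ ∞ (partialFst h) :=
  (hh.fderiv_right (m := ∞) (by simp)).clm_apply contDiff_const

lemma contDiff_partialSnd {h : ℝ × ℝ → ℝ} (hh : ContDiff ℝ ∞ h) :
    ContDiff ℝ ∞ (partialSnd h) :=
  (hh.fderiv_right (m := ∞) (by simp)).clm_apply contDiff_const

lemma hasDerivAt_comp_curve {h : ℝ × ℝ → ℝ} (hh : ContDiff ℝ ∞ h) {α β : ℝ → ℝ} {α' β' s : ℝ}
    (hα : HasDerivAt α α' s) (hβ : HasDerivAt β β' s) :
    HasDerivAt (fun r => h (α r, β r))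
      (α' * partialFst h (α s, β s) + β' * partialSnd h (α s, β s)) s := by
  have h1 := ((hh.differentiable (by simp)) (α s, β s)).hasFDerivAt.comp_hasDerivAt s
    (hα.prodMk hβ)
  have : ((α', β') : ℝ × ℝ) = α' • (1, 0) + β' • (0, 1) := by simp
  rw [this, map_add, map_smul, map_smul] at h1
  exact h1

lemma hasDerivAt_fst {h : ℝ × ℝ → ℝ} (hh : ContDiff ℝ ∞ h) (a b : ℝ) :
    HasDerivAt (fun s => h (s, b)) (partialFst h (a, b)) a := by
  simpa using hasDerivAt_comp_curve hh (hasDerivAt_id a) (hasDerivAt_const a b)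

lemma hasDerivAt_snd {h : ℝ × ℝ → ℝ} (hh : ContDiff ℝ ∞ h) (a b : ℝ) :
    HasDerivAt (fun s => h (a, s)) (partialSnd h (a, b)) b := by
  simpa using hasDerivAt_comp_curve hh (hasDerivAt_const b a) (hasDerivAt_id b)

/-- The potential of the moving gas, `b + ε f(a,b)`. -/
noncomputable def movingPotential (f : ℝ → ℝ → ℝ) (ε : ℝ) (p : ℝ × ℝ) : ℝ := p.2 + ε * f p.1 p.2

section Potential

variable {f : ℝ → ℝ → ℝ} {ε : ℝ}

lemma contDiff_movingPotential (hf : ContDiff ℝ ∞ (Function.uncurry f)) (ε : ℝ) :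
    ContDiff ℝ ∞ (movingPotential f ε) :=
  contDiff_snd.add (contDiff_const.mul hf)

lemma potential_eq_movingPotential {a b : ℝ} (h : movingPotential f ε (a, b) < 0) :
    potential f ε a b = movingPotential f ε (a, b) := by
  simp only [movingPotential] at *
  rw [potential, if_pos (by linarith)]

lemma potential_eq_zero {a b : ℝ} (h : 0 ≤ movingPotential f ε (a, b)) :
    potential f ε a b = 0 := by
  simp only [movingPotential] at *
  rw [potential, if_neg (by linarith)]

variable (hf : ContDiff ℝ ∞ (Function.uncurry f))
include hf

lemma hasDerivAt_potential_plus {a b : ℝ} (h : (a, b) ∈ plusSide f ε) :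
    HasDerivAt (fun s => potential f ε s b) (partialFst (movingPotential f ε) (a, b)) a ∧
    HasDerivAt (fun s => potential f ε a s) (partialSnd (movingPotential f ε) (a, b)) b := by
  have hg := contDiff_movingPotential hf ε
  have hh : movingPotential f ε (a, b) < 0 := h
  constructor
  · refine (hasDerivAt_fst hg a b).congr_of_eventuallyEq ?_
    filter_upwards [(hasDerivAt_fst hg a b).continuousAt.eventually_lt_const hh] with s hs
    exact potential_eq_movingPotential hs
  · refine (hasDerivAt_snd hg a b).congr_of_eventuallyEq ?_
    filter_upwards [(hasDerivAt_snd hg a b).continuousAt.eventually_lt_const hh] with s hs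
    exact potential_eq_movingPotential hs

lemma hasDerivAt_potential_minus {a b : ℝ} (h : (a, b) ∈ minusSide f ε) :
    HasDerivAt (fun s => potential f ε s b) 0 a ∧
    HasDerivAt (fun s => potential f ε a s) 0 b := by
  have hg := contDiff_movingPotential hf ε
  have hh : 0 < movingPotential f ε (a, b) := h
  constructor
  · refine (hasDerivAt_const a 0).congr_of_eventuallyEq ?_
    filter_upwards [(hasDerivAt_fst hg a b).continuousAt.eventually_const_lt hh] with s hs
    exact potential_eq_zero hs.le
  · refine (hasDerivAt_const b 0).congr_of_eventuallyEq ?_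
    filter_upwards [(hasDerivAt_snd hg a b).continuousAt.eventually_const_lt hh] with s hs
    exact potential_eq_zero hs.le

end Potential

/-! ### Critical points and characteristics -/

lemma isCriticalPt_iff {S₀ : ℝ → ℝ → ℝ} {a b t x y u v : ℝ} (ht : t ≠ 0)
    (hu : HasDerivAt (fun s => S₀ s b) u a) (hv : HasDerivAt (fun s => S₀ a s) v b) :
    IsCriticalPt S₀ a b t x y ↔ x = a + t * u ∧ y = b + t * v := by
  have key : ∀ c z : ℝ, HasDerivAt (fun s => (z - s) ^ 2 / (2 * t)) (-(z - c) / t) c := by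
    intro c z
    refine ((((hasDerivAt_id c).const_sub z).fun_pow 2).div_const (2 * t)).congr_deriv ?_
    simp only [id, Nat.cast_ofNat, Nat.add_one_sub_one, pow_one]
    field_simp
  have h1 : HasDerivAt (fun s => hopfLaxFun S₀ s b t x y) (u + -(x - a) / t) a :=
    (hu.fun_add (key a x)).add_const _
  have h2 : HasDerivAt (fun s => hopfLaxFun S₀ a s t x y) (v + -(y - b) / t) b :=
    (hv.add_const _).fun_add (key b y)
  rw [IsCriticalPt, h1.deriv, h2.deriv]
  have e : ∀ c z w : ℝ, w + -(z - c) / t = 0 ↔ z = c + t * w := by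
    intro c z w
    field_simp
    constructor <;> intro h <;> linarith
  rw [e, e]

/-- For small times the characteristics which start in a bounded set do not meet. -/
lemma eventually_injOn_characteristics {h : ℝ × ℝ → ℝ} (hh : ContDiff ℝ ∞ h) {K : Set (ℝ × ℝ)}
    (hK : Bornology.IsBounded K) : ∀ᶠ t in 𝓝[>] (0 : ℝ), ∀ p ∈ K, ∀ q ∈ K,
      p.1 + t * partialFst h p = q.1 + t * partialFst h q →
      p.2 + t * partialSnd h p = q.2 + t * partialSnd h q → p = q := by
  have hψ : ContDiff ℝ 1 fun p : ℝ × ℝ => (partialFst h p, partialSnd h p) :=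
    ((contDiff_partialFst hh).prodMk (contDiff_partialSnd hh)).of_le (by simp)
  obtain ⟨C, hC⟩ := (hψ.locallyLipschitz.locallyLipschitzOn (s := closure K)
    ).exists_lipschitzOnWith_of_compact hK.isCompact_closure
  have h1 : ∀ᶠ t in 𝓝[>] (0 : ℝ), t * (C : ℝ) < 1 := by
    have : Tendsto (fun t : ℝ => t * (C : ℝ)) (𝓝[>] 0) (𝓝 (0 * (C : ℝ))) :=
      ((continuous_id.mul continuous_const).tendsto 0).mono_left nhdsWithin_le_nhds
    rw [zero_mul] at this
    exact this.eventually_lt_const one_pos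
  filter_upwards [h1, self_mem_nhdsWithin] with t ht ht0 p hp q hq e1 e2
  have ht0' : 0 < t := ht0
  have hd := hC.dist_le_mul p (subset_closure hp) q (subset_closure hq)
  have hpq : dist p q =
      t * dist (partialFst h p, partialSnd h p) (partialFst h q, partialSnd h q) := by
    rw [dist_eq_norm, dist_eq_norm, ← abs_of_pos ht0', ← Real.norm_eq_abs, ← norm_smul,
      ← norm_neg]
    congr 1
    ext
    · simp only [Prod.fst_neg, Prod.fst_sub, Prod.smul_fst, smul_eq_mul]; linarith
    · simp only [Prod.snd_neg, Prod.snd_sub, Prod.smul_snd, smul_eq_mul]; linarith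
  by_contra hne
  have hpos := dist_pos.2 hne
  nlinarith [mul_le_mul_of_nonneg_left hd ht0'.le, mul_lt_mul_of_pos_right ht hpos]

/-! ### The variational and Hopf–Lax surfaces at small times -/

section Surfaces

variable {f : ℝ → ℝ → ℝ} {ε : ℝ} (hf : ContDiff ℝ ∞ (Function.uncurry f))
include hf

/-- On the variational surface the potential, transported along the moving characteristics,
vanishes. -/
lemma eventually_variationalSurface_imp {K : Set (ℝ × ℝ)} (hK : Bornology.IsBounded K) :
    ∀ᶠ t in 𝓝[>] (0 : ℝ), ∀ a b x y : ℝ, (a, b) ∈ K →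
      x = a + t * partialFst (movingPotential f ε) (a, b) →
      y = b + t * partialSnd (movingPotential f ε) (a, b) →
      (t, x, y) ∈ variationalSurface (potential f ε) (plusSide f ε) (minusSide f ε) K →
      movingPotential f ε (a, b) + t / 2 * (partialFst (movingPotential f ε) (a, b) ^ 2 +
        partialSnd (movingPotential f ε) (a, b) ^ 2) = 0 := by
  filter_upwards [eventually_injOn_characteristics (contDiff_movingPotential hf ε) hK,
    self_mem_nhdsWithin] with t hinj ht a b x y hab hx hy hz
  have ht' : t ≠ 0 := ne_of_gt ht
  obtain ⟨-, a', b', am, bm, ⟨hp, hpK⟩, ⟨hm, -⟩, hcp, hcm, heq⟩ := hz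
  obtain ⟨d1, d2⟩ := hasDerivAt_potential_plus hf hp
  obtain ⟨d3, d4⟩ := hasDerivAt_potential_minus hf hm
  rw [isCriticalPt_iff ht' d1 d2] at hcp
  rw [isCriticalPt_iff ht' d3 d4] at hcm
  obtain ⟨c1, c2⟩ := hcp
  obtain ⟨c3, c4⟩ := hcm
  simp only [mul_zero, add_zero] at c1 c2 c3 c4
  -- Both are feet in `K` of moving characteristics through the same point, so the foot supplied by
  -- the variational surface is the given one.
  have e : (a, b) = (a', b') := hinj _ hab _ hpK (hx ▸ c1) (hy ▸ c2)
  obtain ⟨rfl, rfl⟩ := Prod.mk.inj e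
  simp only [hopfLaxFun] at heq
  rw [potential_eq_movingPotential hp, potential_eq_zero (le_of_lt hm), c3, c4, sub_self,
    sub_self] at heq
  rw [← c3, ← c4, c1, c2] at heq
  field_simp at heq
  apply mul_left_cancel₀ ht'
  linear_combination heq / 2

/-- Points of the singular set of the Hopf-Lax representation near the initial time belong to the
variational surface. -/
lemma exists_isBounded_hopfLaxSingularSet_imp {z : ℝ × ℝ × ℝ}
    (hz : z ∈ hopfLaxSingularSet (potential f ε)) (R : ℝ) :
    ∃ K : Set (ℝ × ℝ), Bornology.IsBounded K ∧ ∀ᶠ t in 𝓝[>] (0 : ℝ), ∀ x y : ℝ,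
      |x| ≤ R → |y| ≤ R → (x, y) ∈ minusSide f ε →
      (t, x, y) ∈ hopfLaxSingularSet (potential f ε) →
      (t, x, y) ∈ variationalSurface (potential f ε) (plusSide f ε) (minusSide f ε) K := by
  obtain ⟨t₁, x₁, y₁⟩ := z
  obtain ⟨ht₁, p₁, -, -, hp₁, -⟩ := hz
  simp only at ht₁ hp₁
  -- No growth of `f` is assumed. The existence of one global minimum, at time `t₁`, bounds the
  -- potential below by a quadratic function; for `t < t₁ / 4` the quadratic terms of `F` have more
  -- than four times that weight, so `F ≤ 0` confines `(a, b)` to a bounded set.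
  set m := hopfLaxFun (potential f ε) p₁.1 p₁.2 t₁ x₁ y₁ with hm
  have hlow : ∀ a b : ℝ, m ≤ hopfLaxFun (potential f ε) a b t₁ x₁ y₁ :=
    fun a b => hp₁ (mem_univ (a, b))
  set C := t₁ * |m| + 2 * (|x₁| + R) ^ 2 + 2 * (|y₁| + R) ^ 2 with hC
  set K : Set (ℝ × ℝ) := Metric.closedBall 0 (|R| + 1 + C) with hKdef
  have hK : Bornology.IsBounded K := Metric.isBounded_closedBall
  refine ⟨K, hK, ?_⟩
  filter_upwards [eventually_injOn_characteristics (contDiff_movingPotential hf ε) hK,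
    self_mem_nhdsWithin, Ioo_mem_nhdsGT (show (0 : ℝ) < t₁ / 4 by linarith)]
    with t hinj ht htt x y hxR hyR hxy ⟨_, p, q, hpq, hp, hq⟩
  simp only at hp hq
  have ht' : 0 < t := ht
  have hX : hopfLaxFun (potential f ε) x y t x y = 0 := by
    rw [hopfLaxFun, potential_eq_zero (le_of_lt hxy)]; simp
  have hR : 0 ≤ R := (abs_nonneg x).trans hxR
  have hbdd : ∀ a b : ℝ, hopfLaxFun (potential f ε) a b t x y ≤ 0 → (a, b) ∈ K := by
    intro a b hab
    have h1 := hlow a b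
    simp only [hopfLaxFun] at hab h1
    have h2 : ((x - a) ^ 2 + (y - b) ^ 2) * (1 / (2 * t)) ≤ - potential f ε a b := by
      have : ((x - a) ^ 2 + (y - b) ^ 2) * (1 / (2 * t)) =
        (x - a) ^ 2 / (2 * t) + (y - b) ^ 2 / (2 * t) := by ring
      linarith
    have h3 : (2 : ℝ) / t₁ ≤ 1 / (2 * t) := by
      rw [div_le_div_iff₀ ht₁ (by linarith)]; linarith [htt.2]
    have h4 : ((x - a) ^ 2 + (y - b) ^ 2) * (2 / t₁) ≤ - potential f ε a b :=
      (mul_le_mul_of_nonneg_left h3 (by positivity)).trans h2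
    have h5 : ((x - a) ^ 2 + (y - b) ^ 2) * (2 / t₁) ≤
        |m| + ((x₁ - a) ^ 2 + (y₁ - b) ^ 2) / (2 * t₁) := by
      have : ((x₁ - a) ^ 2 + (y₁ - b) ^ 2) / (2 * t₁) =
        (x₁ - a) ^ 2 / (2 * t₁) + (y₁ - b) ^ 2 / (2 * t₁) := by ring
      linarith [neg_abs_le m]
    have h6 : ((x - a) ^ 2 + (y - b) ^ 2) * 4 ≤
        2 * t₁ * |m| + ((x₁ - a) ^ 2 + (y₁ - b) ^ 2) := by
      have := mul_le_mul_of_nonneg_left h5 (show 0 ≤ 2 * t₁ by linarith)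
      have e1 : 2 * t₁ * (((x - a) ^ 2 + (y - b) ^ 2) * (2 / t₁)) =
        ((x - a) ^ 2 + (y - b) ^ 2) * 4 := by field_simp; ring
      have e2 : 2 * t₁ * (|m| + ((x₁ - a) ^ 2 + (y₁ - b) ^ 2) / (2 * t₁)) =
        2 * t₁ * |m| + ((x₁ - a) ^ 2 + (y₁ - b) ^ 2) := by field_simp
      linarith
    have sq_sub_le : ∀ u v : ℝ, |v| ≤ R → (u - v) ^ 2 ≤ (|u| + R) ^ 2 := by
      intro u v hv
      rw [← sq_abs]
      exact pow_le_pow_left₀ (abs_nonneg _) ((abs_sub u v).trans (by linarith)) 2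
    have h7 : (x - a) ^ 2 + (y - b) ^ 2 ≤ C := by
      nlinarith [sq_nonneg (x₁ - x - (x - a)), sq_nonneg (y₁ - y - (y - b)),
        sq_sub_le x₁ x hxR, sq_sub_le y₁ y hyR, abs_nonneg m]
    have coord : ∀ u c : ℝ, |u| ≤ R → (u - c) ^ 2 ≤ C → |c| ≤ |R| + 1 + C := by
      intro u c hu hc
      rw [abs_of_nonneg hR]
      have : |u - c| ≤ 1 + C := by
        rw [← sq_abs] at hc
        nlinarith [abs_nonneg (u - c)]
      have h8 : |c| ≤ |u| + |u - c| := by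
        have := abs_sub u (u - c)
        rwa [sub_sub_cancel] at this
      linarith
    rw [hKdef, mem_closedBall_zero_iff, Prod.norm_def, max_le_iff]
    exact ⟨coord x a hxR (by nlinarith [sq_nonneg (y - b)]),
      coord y b hyR (by nlinarith [sq_nonneg (x - a)])⟩
  have hmin : ∀ r : ℝ × ℝ, IsMinOn (fun r : ℝ × ℝ => hopfLaxFun (potential f ε) r.1 r.2 t x y)
      univ r → r ∈ K ∧ IsCriticalPt (potential f ε) r.1 r.2 t x y ∧
        (r ∈ plusSide f ε ∨ r = (x, y)) := by
    intro r hr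
    have hr' : ∀ a b, hopfLaxFun (potential f ε) r.1 r.2 t x y ≤
      hopfLaxFun (potential f ε) a b t x y := fun a b => hr (mem_univ (a, b))
    have hcrit : IsCriticalPt (potential f ε) r.1 r.2 t x y :=
      ⟨IsLocalMin.deriv_eq_zero (Eventually.of_forall fun s => hr' s r.2),
        IsLocalMin.deriv_eq_zero (Eventually.of_forall fun s => hr' r.1 s)⟩
    have hle := hX ▸ hr' x y
    refine ⟨hbdd _ _ hle, hcrit, ?_⟩
    -- Where `G ≥ 0` the potential vanishes, so `F` is a squared distance over `2t`; being at most
    -- `F(x, y) = 0`, it forces `r = (x, y)`.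
    rcases lt_or_ge (movingPotential f ε r) 0 with h | h
    · exact Or.inl h
    · right
      rw [hopfLaxFun, potential_eq_zero h, zero_add, ← add_div,
        div_le_iff₀ (by linarith), zero_mul] at hle
      ext
      · nlinarith [sq_nonneg (x - r.1), sq_nonneg (y - r.2)]
      · nlinarith [sq_nonneg (x - r.1), sq_nonneg (y - r.2)]
  have hval : hopfLaxFun (potential f ε) p.1 p.2 t x y = hopfLaxFun (potential f ε) q.1 q.2 t x y :=
    le_antisymm (hp (mem_univ q)) (hq (mem_univ p))
  obtain ⟨pK, pc, hp'⟩ := hmin p hp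
  obtain ⟨qK, qc, hq'⟩ := hmin q hq
  rcases hp' with hp' | rfl <;> rcases hq' with hq' | rfl
  · refine absurd (hinj p pK q qK ?_ ?_) hpq
    all_goals
      obtain ⟨d1, d2⟩ := hasDerivAt_potential_plus hf hp'
      obtain ⟨d3, d4⟩ := hasDerivAt_potential_plus hf hq'
      rw [isCriticalPt_iff ht'.ne' d1 d2] at pc
      rw [isCriticalPt_iff ht'.ne' d3 d4] at qc
    · exact pc.1.symm.trans qc.1
    · exact pc.2.symm.trans qc.2
  · exact ⟨ht', p.1, p.2, x, y, ⟨hp', pK⟩, ⟨hxy, qK⟩, pc, qc, hval⟩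
  · exact ⟨ht', q.1, q.2, x, y, ⟨hq', qK⟩, ⟨hxy, pK⟩, qc, pc, hval.symm⟩
  · exact absurd rfl hpq

end Surfaces

/-! ### Curved points of the initial curve -/

lemma partialFst_const_add_mul {h : ℝ × ℝ → ℝ} (hh : ContDiff ℝ ∞ h) (c ε : ℝ) (p : ℝ × ℝ) :
    partialFst (fun q => c + ε * h q) p = ε * partialFst h p :=
  (hasDerivAt_fst (contDiff_const.add (contDiff_const.mul hh)) p.1 p.2).unique
    (((hasDerivAt_fst hh p.1 p.2).const_mul ε).const_add c)

lemma partialSnd_const_add_mul {h : ℝ × ℝ → ℝ} (hh : ContDiff ℝ ∞ h) (c ε : ℝ) (p : ℝ × ℝ) :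
    partialSnd (fun q => c + ε * h q) p = ε * partialSnd h p :=
  (hasDerivAt_snd (contDiff_const.add (contDiff_const.mul hh)) p.1 p.2).unique
    (((hasDerivAt_snd hh p.1 p.2).const_mul ε).const_add c)

/-- The summand `0 +` gives the shape `c + ε * h q`, so that second derivatives follow by rewriting
with `partialFst_const_add_mul` and `partialSnd_const_add_mul`. -/
lemma partialFst_movingPotential {f : ℝ → ℝ → ℝ} (hf : ContDiff ℝ ∞ (Function.uncurry f))
    (ε : ℝ) : partialFst (movingPotential f ε) =
      fun p => 0 + ε * partialFst (Function.uncurry f) p := by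
  ext p
  rw [zero_add]
  exact (hasDerivAt_fst (contDiff_movingPotential hf ε) p.1 p.2).unique
    (((hasDerivAt_fst hf p.1 p.2).const_mul ε).const_add p.2)

lemma partialSnd_movingPotential {f : ℝ → ℝ → ℝ} (hf : ContDiff ℝ ∞ (Function.uncurry f))
    (ε : ℝ) : partialSnd (movingPotential f ε) =
      fun p => 1 + ε * partialSnd (Function.uncurry f) p := by
  ext p
  exact (hasDerivAt_snd (contDiff_movingPotential hf ε) p.1 p.2).unique
    ((hasDerivAt_id p.2).fun_add ((hasDerivAt_snd hf p.1 p.2).const_mul ε))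

/-- The curvature of the level line of `h` through `p`, up to a power of `|∇h|`. -/
noncomputable def levelCurvature (h : ℝ × ℝ → ℝ) (p : ℝ × ℝ) : ℝ :=
  partialFst h p * (partialFst h p * partialSnd (partialSnd h) p -
      partialSnd h p * partialFst (partialSnd h) p) -
    partialSnd h p * (partialFst h p * partialSnd (partialFst h) p -
      partialSnd h p * partialFst (partialFst h) p)

/-- After division by `ε` the level curvature depends continuously on `(ε, b)`, with value `f_aa(a,
0) ≠ 0` at the origin; the intermediate value theorem finds a point of the curve above `a` with `b`
small. -/
lemma exists_curved_point {f : ℝ → ℝ → ℝ} (hf : ContDiff ℝ ∞ (Function.uncurry f))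
    {U : Set (ℝ × ℝ)} (hU : IsOpen U) {a : ℝ} (ha : (a, (0 : ℝ)) ∈ U)
    (hfaa : deriv (deriv (fun s => f s 0)) a ≠ 0) :
    ∃ ε₀ : ℝ, 0 < ε₀ ∧ ∀ ε : ℝ, 0 < ε → ε < ε₀ → ∃ b : ℝ, (a, b) ∈ U ∧
      (a, b) ∈ initialCurve f ε ∧ partialSnd (movingPotential f ε) (a, b) ≠ 0 ∧
      levelCurvature (movingPotential f ε) (a, b) ≠ 0 := by
  set F := Function.uncurry f with hF
  have h1 := contDiff_partialFst hf
  have h2 := contDiff_partialSnd hf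
  have c1 := h1.continuous
  have c2 := h2.continuous
  have c11 := (contDiff_partialFst h1).continuous
  have c12 := (contDiff_partialFst h2).continuous
  have c21 := (contDiff_partialSnd h1).continuous
  have c22 := (contDiff_partialSnd h2).continuous
  have hfaa' : partialFst (partialFst F) (a, 0) ≠ 0 := by
    have e : deriv (fun s => f s 0) = fun s => partialFst F (s, 0) :=
      funext fun s => (hasDerivAt_fst hf s 0).deriv
    rwa [e, (hasDerivAt_fst h1 a 0).deriv] at hfaa
  let Q : ℝ × ℝ → ℝ := fun z =>
    z.1 * partialFst F (a, z.2) * (z.1 * partialFst F (a, z.2) * partialSnd (partialSnd F) (a, z.2) -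
      (1 + z.1 * partialSnd F (a, z.2)) * partialFst (partialSnd F) (a, z.2)) -
    (1 + z.1 * partialSnd F (a, z.2)) *
      (z.1 * partialFst F (a, z.2) * partialSnd (partialFst F) (a, z.2) -
      (1 + z.1 * partialSnd F (a, z.2)) * partialFst (partialFst F) (a, z.2))
  have hQ : Continuous Q := by fun_prop
  have hw : Continuous fun z : ℝ × ℝ => 1 + z.1 * partialSnd F (a, z.2) := by fun_prop
  have hE : ∀ᶠ z : ℝ × ℝ in 𝓝 (0, 0), (a, z.2) ∈ U ∧
      1 + z.1 * partialSnd F (a, z.2) ≠ 0 ∧ Q z ≠ 0 := by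
    refine (ContinuousAt.eventually_mem (f := fun z : ℝ × ℝ => (a, z.2)) (by fun_prop)
      (hU.mem_nhds ha)).and ((hw.continuousAt.eventually_ne ?_).and
      (hQ.continuousAt.eventually_ne ?_))
    · simp
    · simpa [Q] using hfaa'
  obtain ⟨r, hr, hball⟩ := Metric.eventually_nhds_iff.1 hE
  have cF : Continuous fun b => F (a, b) := by
    have := hf.continuous
    fun_prop
  obtain ⟨M, hM⟩ := (isCompact_Icc (a := -(r / 2)) (b := r / 2)).exists_bound_of_continuousOn
    cF.continuousOn
  have hM0 : 0 ≤ M := (norm_nonneg _).trans (hM 0 ⟨by linarith, by linarith⟩)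
  -- The second bound makes `|ε f(a, b)| ≤ r / 2` for `|b| ≤ r / 2`, so `b + ε f(a, b)` changes sign
  -- there; both keep `(ε, b)` in the ball of radius `r`.
  refine ⟨min r (r / 2 / (M + 1)), by positivity, fun ε hε hεr => ?_⟩
  have hεM : ε * (M + 1) < r / 2 := by
    have := hεr.trans_le (min_le_right _ _)
    rwa [lt_div_iff₀ (by positivity)] at this
  have hbound : ∀ b ∈ Icc (-(r / 2)) (r / 2), |ε * F (a, b)| ≤ r / 2 := by
    intro b hb
    rw [abs_mul, abs_of_pos hε]
    have := mul_le_mul_of_nonneg_left (hM b hb) hε.le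
    rw [Real.norm_eq_abs] at this
    nlinarith
  have hivt := intermediate_value_Icc (show -(r / 2) ≤ r / 2 by linarith)
    (f := fun b => b + ε * F (a, b))
    (continuous_id.add (continuous_const.mul cF)).continuousOn
  obtain ⟨b, hb, hb0⟩ := hivt (show (0 : ℝ) ∈ _ from
    ⟨by linarith [(abs_le.1 (hbound (-(r / 2)) ⟨le_rfl, by linarith⟩)).2],
      by linarith [(abs_le.1 (hbound (r / 2) ⟨by linarith, le_rfl⟩)).1]⟩)
  have hd : dist (ε, b) ((0 : ℝ), (0 : ℝ)) < r := by
    rw [Prod.dist_eq, max_lt_iff, Real.dist_0_eq_abs, Real.dist_0_eq_abs, abs_of_pos hε]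
    exact ⟨hεr.trans_le (min_le_left _ _), (abs_le.2 hb).trans_lt (by linarith)⟩
  obtain ⟨q1, q2, q3⟩ := hball hd
  refine ⟨b, q1, hb0, ?_, ?_⟩
  · rw [partialSnd_movingPotential hf]
    exact q2
  · have e : levelCurvature (movingPotential f ε) (a, b) = ε * Q (ε, b) := by
      rw [levelCurvature, partialFst_movingPotential hf, partialSnd_movingPotential hf,
        partialFst_const_add_mul h1, partialFst_const_add_mul h2, partialSnd_const_add_mul h1,
        partialSnd_const_add_mul h2]
      simp only [Q]
      ring
    rw [e]
    exact mul_ne_zero hε.ne' q3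

/-! ### The front near a curved point -/

section Front

variable {f : ℝ → ℝ → ℝ} {ε : ℝ} {L : Set ℝ} {A B T : ℝ → ℝ} {x y ap bp am bm : ℝ → ℝ → ℝ}

lemma IsShockFront.minus_eq (hf : ContDiff ℝ ∞ (Function.uncurry f))
    (h : IsShockFront (fun _ _ => 1) (potential f ε) (plusSide f ε) (minusSide f ε)
      L A B T x y ap bp am bm) {l t : ℝ} (hl : l ∈ L) (ht : 0 < t) (htT : t < T l) :
    velU (potential f ε) (am t l) (bm t l) = 0 ∧ velV (potential f ε) (am t l) (bm t l) = 0 ∧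
      am t l = x t l ∧ bm t l = y t l := by
  obtain ⟨d1, d2⟩ := hasDerivAt_potential_minus hf (h.mem_minus l hl t ht htT)
  have e1 : velU (potential f ε) (am t l) (bm t l) = 0 := d1.deriv
  have e2 : velV (potential f ε) (am t l) (bm t l) = 0 := d2.deriv
  have := h.characteristic_minus l hl t ht htT
  rw [e1, e2, mul_zero, add_zero, add_zero] at this
  exact ⟨e1, e2, this.1.symm, this.2.symm⟩

lemma IsShockFront.plus_eq (hf : ContDiff ℝ ∞ (Function.uncurry f))
    (h : IsShockFront (fun _ _ => 1) (potential f ε) (plusSide f ε) (minusSide f ε)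
      L A B T x y ap bp am bm) {l t : ℝ} (hl : l ∈ L) (ht : 0 < t) (htT : t < T l) :
    velU (potential f ε) (ap t l) (bp t l) = partialFst (movingPotential f ε) (ap t l, bp t l) ∧
    velV (potential f ε) (ap t l) (bp t l) = partialSnd (movingPotential f ε) (ap t l, bp t l) ∧
    x t l = ap t l + t * partialFst (movingPotential f ε) (ap t l, bp t l) ∧
    y t l = bp t l + t * partialSnd (movingPotential f ε) (ap t l, bp t l) := by
  obtain ⟨d1, d2⟩ := hasDerivAt_potential_plus hf (h.mem_plus l hl t ht htT)
  have e1 : velU (potential f ε) (ap t l) (bp t l) = _ := d1.deriv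
  have e2 : velV (potential f ε) (ap t l) (bp t l) = _ := d2.deriv
  have := h.characteristic_plus l hl t ht htT
  rw [e1, e2] at this
  exact ⟨e1, e2, this.1, this.2⟩

/-- The integrands need to agree only for `τ > 0`: at `τ = 0` the feet lie on the curve, where the
velocity formulas of the two sides are not available. -/
lemma collected_eq {g : ℝ → ℝ → ℝ} {k : ℝ → ℝ} {t l c : ℝ} (ht : 0 < t) (htc : t < c)
    (hk : ∀ τ, 0 < τ → τ < c → g (ap τ l) (bp τ l) * jacobian ap bp τ l -
      g (am τ l) (bm τ l) * jacobian am bm τ l = k τ) :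
    collected g ap bp am bm t l = ∫ τ in (0 : ℝ)..t, k τ := by
  refine intervalIntegral.integral_congr_ae (Eventually.of_forall fun τ hτ => ?_)
  rw [uIoc_of_le ht.le] at hτ
  exact hk τ hτ.1 (hτ.2.trans_lt htc)

/-- The potential cannot be continuous across the front near a point of the initial curve with
nonzero curvature. -/
theorem IsShockFront.not_eventually_potential_continuous
    (hf : ContDiff ℝ ∞ (Function.uncurry f))
    (h : IsShockFront (fun _ _ => 1) (potential f ε) (plusSide f ε) (minusSide f ε)
      L A B T x y ap bp am bm)
    (hcurve : ∀ l ∈ L, (A l, B l) ∈ initialCurve f ε) {l₀ : ℝ} (hl₀ : l₀ ∈ L)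
    (hgrad : partialSnd (movingPotential f ε) (A l₀, B l₀) ≠ 0)
    (hcurv : levelCurvature (movingPotential f ε) (A l₀, B l₀) ≠ 0) :
    ¬ ∀ᶠ p in 𝓝[>] (0 : ℝ) ×ˢ 𝓝 l₀,
      movingPotential f ε (ap p.1 p.2, bp p.1 p.2) +
        p.1 / 2 * (partialFst (movingPotential f ε) (ap p.1 p.2, bp p.1 p.2) ^ 2 +
          partialSnd (movingPotential f ε) (ap p.1 p.2, bp p.1 p.2) ^ 2) = 0 := by
  intro hE
  have hL := h.isOpen_param
  have hT := h.lifetime_lsc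
  have hT0 := h.lifetime_pos
  set G := movingPotential f ε with hG
  have hGc : ContDiff ℝ ∞ G := contDiff_movingPotential hf ε
  have hG1 := contDiff_partialFst hGc
  have hG2 := contDiff_partialSnd hGc
  -- The gradient of the smooth function `G` replaces `velU` and `velV`: it agrees with them on the
  -- plus side and remains `C¹` up to `t = 0`.
  let w₁ : ℝ → ℝ → ℝ := fun t l => partialFst G (ap t l, bp t l)
  let w₂ : ℝ → ℝ → ℝ := fun t l => partialSnd G (ap t l, bp t l)
  have hw₁ : ContDiffOn ℝ 1 (Function.uncurry w₁) (frontDomain L T) :=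
    (hG1.of_le (by simp)).comp_contDiffOn (h.contDiff_ap.prodMk h.contDiff_bp)
  have hw₂ : ContDiffOn ℝ 1 (Function.uncurry w₂) (frontDomain L T) :=
    (hG2.of_le (by simp)).comp_contDiffOn (h.contDiff_ap.prodMk h.contDiff_bp)
  obtain ⟨xt, xl, cxt, cxl, dx, dx0⟩ := exists_partials hL hT hT0 h.contDiff_x
  obtain ⟨yt, yl, cyt, cyl, dy, dy0⟩ := exists_partials hL hT hT0 h.contDiff_y
  obtain ⟨at', al, cat, cal, da, da0⟩ := exists_partials hL hT hT0 h.contDiff_ap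
  obtain ⟨bt, bl, cbt, cbl, db, db0⟩ := exists_partials hL hT hT0 h.contDiff_bp
  obtain ⟨w₁t, w₁l, cw₁t, cw₁l, dw₁, dw₁0⟩ := exists_partials hL hT hT0 hw₁
  obtain ⟨w₂t, w₂l, cw₂t, cw₂l, dw₂, dw₂0⟩ := exists_partials hL hT hT0 hw₂
  -- restriction to the line `l = l₀`
  have hline : ∀ t, 0 ≤ t → t < T l₀ → (t, l₀) ∈ frontDomain L T := fun t h1 h2 => ⟨hl₀, h1, h2⟩
  have cline : ∀ {φ : ℝ × ℝ → ℝ}, ContinuousOn φ (frontDomain L T) →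
      ContinuousOn (fun t => φ (t, l₀)) (Ico 0 (T l₀)) := fun hφ =>
    hφ.comp (by fun_prop) fun t ht => hline t ht.1 ht.2
  have tline : ∀ {φ : ℝ × ℝ → ℝ}, ContinuousOn φ (frontDomain L T) →
      Tendsto (fun t => φ (t, l₀)) (𝓝[>] 0) (𝓝 (φ (0, l₀))) := fun hφ =>
    ((cline hφ 0 ⟨le_rfl, hT0 l₀ hl₀⟩).mono_of_mem_nhdsWithin
      (Ico_mem_nhdsGE (hT0 l₀ hl₀))).mono_left (nhdsWithin_mono _ Ioi_subset_Ici_self)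
  have hsmall : ∀ᶠ t in 𝓝[>] (0 : ℝ), 0 < t ∧ t < T l₀ := Ioo_mem_nhdsGT (hT0 l₀ hl₀)
  -- the relations between the partial derivatives
  have hnear : ∀ t, 0 < t → t < T l₀ → ∀ᶠ q in 𝓝 (t, l₀), q ∈ frontDomain L T ∧ 0 < q.1 :=
    fun t h1 h2 => Eventually.and (frontDomain_mem_nhds hL hT (hline t h1.le h2) h1)
      (continuous_fst.continuousAt.eventually_const_lt h1)
  have slice₁ : ∀ {t : ℝ} {Φ : ℝ × ℝ → Prop}, (∀ᶠ q in 𝓝 (t, l₀), Φ q) →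
      ∀ᶠ s in 𝓝 t, Φ (s, l₀) := fun hΦ => (Continuous.prodMk_left l₀).continuousAt.eventually hΦ
  have slice₂ : ∀ {t : ℝ} {Φ : ℝ × ℝ → Prop}, (∀ᶠ q in 𝓝 (t, l₀), Φ q) →
      ∀ᶠ m in 𝓝 l₀, Φ (t, m) := fun hΦ => (Continuous.prodMk_right _).continuousAt.eventually hΦ
  have hrel : ∀ t, 0 < t → t < T l₀ →
      (xt (t, l₀) = at' (t, l₀) + w₁ t l₀ + t * w₁t (t, l₀) ∧
        yt (t, l₀) = bt (t, l₀) + w₂ t l₀ + t * w₂t (t, l₀)) ∧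
      (xl (t, l₀) = al (t, l₀) + t * w₁l (t, l₀) ∧
        yl (t, l₀) = bl (t, l₀) + t * w₂l (t, l₀)) := by
    intro t h1 h2
    have hp := hline t h1.le h2
    have n : ∀ᶠ q in 𝓝 (t, l₀), x q.1 q.2 = ap q.1 q.2 + q.1 * w₁ q.1 q.2 ∧
        y q.1 q.2 = bp q.1 q.2 + q.1 * w₂ q.1 q.2 :=
      (hnear t h1 h2).mono fun q hq => (h.plus_eq hf hq.1.1 hq.2 hq.1.2.2).2.2
    refine ⟨⟨?_, ?_⟩, ?_, ?_⟩
    · refine ((dx _ hp h1).1.congr_of_eventuallyEq (EventuallyEq.symm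
        (slice₁ (n.mono fun _ h => h.1)))).unique (((da _ hp h1).1.fun_add
        ((hasDerivAt_id t).fun_mul (dw₁ _ hp h1).1)).congr_deriv ?_)
      simp only [id]; ring
    · refine ((dy _ hp h1).1.congr_of_eventuallyEq (EventuallyEq.symm
        (slice₁ (n.mono fun _ h => h.2)))).unique (((db _ hp h1).1.fun_add
        ((hasDerivAt_id t).fun_mul (dw₂ _ hp h1).1)).congr_deriv ?_)
      simp only [id]; ring
    · exact ((dx _ hp h1).2.congr_of_eventuallyEq (EventuallyEq.symm
        (slice₂ (n.mono fun _ h => h.1)))).unique ((da _ hp h1).2.fun_add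
        ((dw₁ _ hp h1).2.const_mul t))
    · exact ((dy _ hp h1).2.congr_of_eventuallyEq (EventuallyEq.symm
        (slice₂ (n.mono fun _ h => h.2)))).unique ((db _ hp h1).2.fun_add
        ((dw₂ _ hp h1).2.const_mul t))
  -- the front is tangent to the jump of the potential
  have hE' : ∀ᶠ t in 𝓝[>] (0 : ℝ), ∀ᶠ q in 𝓝 (t, l₀),
      G (ap q.1 q.2, bp q.1 q.2) + q.1 / 2 * (w₁ q.1 q.2 ^ 2 + w₂ q.1 q.2 ^ 2) = 0 := by
    -- At positive times the one-sided filter is a full neighbourhood, so the relation may be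
    -- differentiated in both variables.
    have e : 𝓝[>] (0 : ℝ) ×ˢ 𝓝 l₀ = 𝓝[Ioi (0 : ℝ) ×ˢ univ] (0, l₀) := by
      rw [nhdsWithin_prod_eq, nhdsWithin_univ]
    rw [e] at hE
    have h1 := eventually_eventually_nhdsWithin.2 hE
    rw [← e] at h1
    have h2 : Tendsto (fun t : ℝ => (t, l₀)) (𝓝[>] 0) (𝓝[>] (0 : ℝ) ×ˢ 𝓝 l₀) :=
      tendsto_id.prodMk tendsto_const_nhds
    filter_upwards [h2.eventually h1, self_mem_nhdsWithin] with t h3 h4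
    rwa [nhdsWithin_eq_nhds.2 (prod_mem_nhds (Ioi_mem_nhds h4) univ_mem)] at h3
  have htan : ∀ᶠ t in 𝓝[>] (0 : ℝ),
      w₁ t l₀ * xl (t, l₀) + w₂ t l₀ * yl (t, l₀) = 0 ∧
      w₁ t l₀ * xt (t, l₀) + w₂ t l₀ * yt (t, l₀) = (w₁ t l₀ ^ 2 + w₂ t l₀ ^ 2) / 2 := by
    filter_upwards [hE', hsmall] with t he ⟨h1, h2⟩
    have hp := hline t h1.le h2
    obtain ⟨⟨r1, r2⟩, r3, r4⟩ := hrel t h1 h2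
    have s1 := (((hasDerivAt_comp_curve hGc (da _ hp h1).1 (db _ hp h1).1).fun_add
      (((hasDerivAt_id t).div_const 2).fun_mul (((dw₁ _ hp h1).1.fun_pow 2).fun_add
        ((dw₂ _ hp h1).1.fun_pow 2)))).congr_of_eventuallyEq
          (EventuallyEq.symm (slice₁ he))).unique (hasDerivAt_const t 0)
    have s2 := (((hasDerivAt_comp_curve hGc (da _ hp h1).2 (db _ hp h1).2).fun_add
      ((((dw₁ _ hp h1).2.fun_pow 2).fun_add
        ((dw₂ _ hp h1).2.fun_pow 2)).const_mul (t / 2))).congr_of_eventuallyEq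
          (EventuallyEq.symm (slice₂ he))).unique (hasDerivAt_const l₀ 0)
    simp only [id, Nat.cast_ofNat, Nat.add_one_sub_one, pow_one] at s1 s2
    constructor
    · rw [r3, r4]
      linear_combination s2
    · rw [r1, r2]
      linear_combination s1
  -- the collected mass and momentum
  have hjp : ∀ τ, 0 < τ → τ < T l₀ → jacobian ap bp τ l₀ =
      at' (τ, l₀) * bl (τ, l₀) - bt (τ, l₀) * al (τ, l₀) := by
    intro τ h1 h2
    have hp := hline τ h1.le h2
    rw [jacobian, (da _ hp h1).1.deriv, (da _ hp h1).2.deriv, (db _ hp h1).1.deriv,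
      (db _ hp h1).2.deriv]
  have hjm : ∀ τ, 0 < τ → τ < T l₀ → jacobian am bm τ l₀ =
      xt (τ, l₀) * yl (τ, l₀) - yt (τ, l₀) * xl (τ, l₀) := by
    intro τ h1 h2
    have hp := hline τ h1.le h2
    have n : ∀ᶠ q in 𝓝 (τ, l₀), am q.1 q.2 = x q.1 q.2 ∧ bm q.1 q.2 = y q.1 q.2 :=
      (hnear τ h1 h2).mono fun q hq => (h.minus_eq hf hq.1.1 hq.2 hq.1.2.2).2.2
    have na := n.mono fun _ h => h.1
    have nb := n.mono fun _ h => h.2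
    rw [jacobian, ((dx _ hp h1).1.congr_of_eventuallyEq (slice₁ na)).deriv,
      ((dx _ hp h1).2.congr_of_eventuallyEq (slice₂ na)).deriv,
      ((dy _ hp h1).1.congr_of_eventuallyEq (slice₁ nb)).deriv,
      ((dy _ hp h1).2.congr_of_eventuallyEq (slice₂ nb)).deriv]
  have hD := ((cat.mul cbl).sub (cbt.mul cal))
  have cP := cline (hD.sub ((cxt.mul cyl).sub (cyt.mul cxl)))
  have cI := cline (hw₁.continuousOn.mul hD)
  have cJ := cline (hw₂.continuousOn.mul hD)
  have hRH : ∀ᶠ t in 𝓝[>] (0 : ℝ),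
      (∫ τ in (0 : ℝ)..t, ((at' (τ, l₀) * bl (τ, l₀) - bt (τ, l₀) * al (τ, l₀)) -
        (xt (τ, l₀) * yl (τ, l₀) - yt (τ, l₀) * xl (τ, l₀)))) ≠ 0 ∧
      xt (t, l₀) = (∫ τ in (0 : ℝ)..t, w₁ τ l₀ *
        (at' (τ, l₀) * bl (τ, l₀) - bt (τ, l₀) * al (τ, l₀))) /
        (∫ τ in (0 : ℝ)..t, ((at' (τ, l₀) * bl (τ, l₀) - bt (τ, l₀) * al (τ, l₀)) -
          (xt (τ, l₀) * yl (τ, l₀) - yt (τ, l₀) * xl (τ, l₀)))) ∧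
      yt (t, l₀) = (∫ τ in (0 : ℝ)..t, w₂ τ l₀ *
        (at' (τ, l₀) * bl (τ, l₀) - bt (τ, l₀) * al (τ, l₀))) /
        (∫ τ in (0 : ℝ)..t, ((at' (τ, l₀) * bl (τ, l₀) - bt (τ, l₀) * al (τ, l₀)) -
          (xt (τ, l₀) * yl (τ, l₀) - yt (τ, l₀) * xl (τ, l₀)))) := by
    filter_upwards [hsmall] with t ⟨h1, h2⟩
    have hp := hline t h1.le h2
    have r := h.rankine_hugoniot l₀ hl₀ t h1 h2
    rw [(dx _ hp h1).1.deriv, (dy _ hp h1).1.deriv] at r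
    rwa [collected_eq (k := fun τ =>
        (at' (τ, l₀) * bl (τ, l₀) - bt (τ, l₀) * al (τ, l₀)) -
        (xt (τ, l₀) * yl (τ, l₀) - yt (τ, l₀) * xl (τ, l₀))) h1 h2 fun τ g1 g2 => by
          rw [hjp τ g1 g2, hjm τ g1 g2, one_mul, one_mul],
      collected_eq (k := fun τ => w₁ τ l₀ *
        (at' (τ, l₀) * bl (τ, l₀) - bt (τ, l₀) * al (τ, l₀))) h1 h2 fun τ g1 g2 => by
          rw [hjp τ g1 g2, (h.minus_eq hf hl₀ g1 g2).1, (h.plus_eq hf hl₀ g1 g2).1]; ring,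
      collected_eq (k := fun τ => w₂ τ l₀ *
        (at' (τ, l₀) * bl (τ, l₀) - bt (τ, l₀) * al (τ, l₀))) h1 h2 fun τ g1 g2 => by
          rw [hjp τ g1 g2, (h.minus_eq hf hl₀ g1 g2).2.1, (h.plus_eq hf hl₀ g1 g2).2.1]; ring] at r
  -- the initial values
  have hLn : ∀ᶠ l in 𝓝 l₀, l ∈ L := hL.mem_nhds hl₀
  have dA : HasDerivAt A (xl (0, l₀)) l₀ := (dx0 l₀ hl₀).congr_of_eventuallyEq
    (hLn.mono fun l hl => (h.initial l hl).1.symm)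
  have dB : HasDerivAt B (yl (0, l₀)) l₀ := (dy0 l₀ hl₀).congr_of_eventuallyEq
    (hLn.mono fun l hl => (h.initial l hl).2.1.symm)
  have hreg : xl (0, l₀) ^ 2 + yl (0, l₀) ^ 2 ≠ 0 := by
    have := h.regular l₀ hl₀
    rwa [dA.deriv, dB.deriv] at this
  have hcoord : ∀ l ∈ L, (ap 0 l, bp 0 l) = (A l, B l) := fun l hl => by
    rw [(h.initial l hl).2.2.1, (h.initial l hl).2.2.2.1]
  have ew₁ : w₁ 0 l₀ = partialFst G (A l₀, B l₀) := by simp only [w₁, hcoord l₀ hl₀]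
  have ew₂ : w₂ 0 l₀ = partialSnd G (A l₀, B l₀) := by simp only [w₂, hcoord l₀ hl₀]
  have ew₁l : w₁l (0, l₀) = xl (0, l₀) * partialFst (partialFst G) (A l₀, B l₀) +
      yl (0, l₀) * partialSnd (partialFst G) (A l₀, B l₀) :=
    ((dw₁0 l₀ hl₀).congr_of_eventuallyEq (hLn.mono fun l hl => by
      simp only [w₁, hcoord l hl])).unique (hasDerivAt_comp_curve hG1 dA dB)
  have ew₂l : w₂l (0, l₀) = xl (0, l₀) * partialFst (partialSnd G) (A l₀, B l₀) +
      yl (0, l₀) * partialSnd (partialSnd G) (A l₀, B l₀) :=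
    ((dw₂0 l₀ hl₀).congr_of_eventuallyEq (hLn.mono fun l hl => by
      simp only [w₂, hcoord l hl])).unique (hasDerivAt_comp_curve hG2 dA dB)
  have horth : xl (0, l₀) * w₁ 0 l₀ + yl (0, l₀) * w₂ 0 l₀ = 0 := by
    rw [ew₁, ew₂]
    exact ((hasDerivAt_comp_curve hGc dA dB).congr_of_eventuallyEq
      (hLn.mono fun l hl => (hcurve l hl).symm)).unique (hasDerivAt_const l₀ 0)
  have hw0 : w₁ 0 l₀ ^ 2 + w₂ 0 l₀ ^ 2 ≠ 0 := by
    have : 0 < w₂ 0 l₀ ^ 2 := by rw [ew₂]; positivity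
    positivity
  have hκ : w₁ 0 l₀ * yl (0, l₀) - w₂ 0 l₀ * xl (0, l₀) ≠ 0 := by
    intro hκ
    -- Lagrange's identity `|w|² |X_l|² = (w × X_l)² + (w · X_l)²`.
    refine mul_ne_zero hw0 hreg ?_
    linear_combination (w₁ 0 l₀ * yl (0, l₀) - w₂ 0 l₀ * xl (0, l₀)) * hκ +
      (xl (0, l₀) * w₁ 0 l₀ + yl (0, l₀) * w₂ 0 l₀) * horth
  have hcross := cross_eq_zero_of_tangency (w₁ := fun t => w₁ t l₀) (w₂ := fun t => w₂ t l₀)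
    (w₁t := fun t => w₁t (t, l₀)) (w₂t := fun t => w₂t (t, l₀))
    (w₁l := fun t => w₁l (t, l₀)) (w₂l := fun t => w₂l (t, l₀))
    (xt := fun t => xt (t, l₀)) (yt := fun t => yt (t, l₀))
    (xl := fun t => xl (t, l₀)) (yl := fun t => yl (t, l₀))
    (at' := fun t => at' (t, l₀)) (bt := fun t => bt (t, l₀))
    (al := fun t => al (t, l₀)) (bl := fun t => bl (t, l₀))
    (tline hw₁.continuousOn) (tline hw₂.continuousOn) (tline cw₁t) (tline cw₂t) (tline cw₁l)
    (tline cw₂l) (tline cxt) (tline cyt) (tline cxl) (tline cyl) (tline cat) (tline cbt)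
    (tline cal) (tline cbl)
    (tendsto_integral_div_of_continuousOn_Ico (hT0 l₀ hl₀) cP)
    (tendsto_integral_div_of_continuousOn_Ico (hT0 l₀ hl₀) cI)
    (tendsto_integral_div_of_continuousOn_Ico (hT0 l₀ hl₀) cJ)
    (hsmall.mono fun t ht => (dw₁ _ (hline t ht.1.le ht.2) ht.1).1)
    (hsmall.mono fun t ht => (dw₂ _ (hline t ht.1.le ht.2) ht.1).1)
    (hsmall.mono fun t ht => hasDerivAt_integral_of_continuousOn_Ico cP ht)
    (hsmall.mono fun t ht => hasDerivAt_integral_of_continuousOn_Ico cI ht)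
    (hsmall.mono fun t ht => hasDerivAt_integral_of_continuousOn_Ico cJ ht)
    (hsmall.mono fun t ht => (hrel t ht.1 ht.2).1.1)
    (hsmall.mono fun t ht => (hrel t ht.1 ht.2).1.2)
    (hsmall.mono fun t ht => (hrel t ht.1 ht.2).2.1)
    (hsmall.mono fun t ht => (hrel t ht.1 ht.2).2.2)
    (htan.mono fun t ht => ht.1) (htan.mono fun t ht => ht.2) hRH hw0 hκ
  simp only [ew₁l, ew₂l] at hcross
  rw [levelCurvature, ← ew₁, ← ew₂] at hcurv
  -- Since `X_l` is orthogonal to `w`, it equals `(κ / |w|²)(-w₂, w₁)` with `κ = w × X_l`; hence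
  -- `|w|² (w × w_l)` is `κ` times the level curvature.
  refine mul_ne_zero hκ hcurv ?_
  set d11 := partialFst (partialFst G) (A l₀, B l₀)
  set d21 := partialSnd (partialFst G) (A l₀, B l₀)
  set d12 := partialFst (partialSnd G) (A l₀, B l₀)
  set d22 := partialSnd (partialSnd G) (A l₀, B l₀)
  linear_combination (w₁ 0 l₀ ^ 2 + w₂ 0 l₀ ^ 2) * hcross +
    (w₁ 0 l₀ * (- w₁ 0 l₀ * d12 - w₂ 0 l₀ * d22) +
      w₂ 0 l₀ * (w₁ 0 l₀ * d11 + w₂ 0 l₀ * d21)) * horth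

end Front

/-! ### Conclusion -/

lemma variationalSurface_mono {S₀ : ℝ → ℝ → ℝ} {Gp Gm K K' : Set (ℝ × ℝ)} (h : K ⊆ K') :
    variationalSurface S₀ Gp Gm K ⊆ variationalSurface S₀ Gp Gm K' := by
  rintro z ⟨hz, a, b, c, d, hp, hm, hrest⟩
  exact ⟨hz, a, b, c, d, ⟨hp.1, h hp.2⟩, ⟨hm.1, h hm.2⟩, hrest⟩

end PressurelessGas

open PressurelessGas in
theorem theorem3p1 (f : ℝ → ℝ → ℝ) (hf : ContDiff ℝ ∞ (Function.uncurry f)) (hf0 : f 0 0 = 0)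
    (U : Set (ℝ × ℝ)) (hU : IsOpen U) (hU0 : ((0 : ℝ), (0 : ℝ)) ∈ U)
    (hfaa : ∃ a : ℝ, (a, (0 : ℝ)) ∈ U ∧ deriv (deriv (fun s => f s 0)) a ≠ 0)
    (hmono : ∀ᶠ ε in 𝓝[>] (0 : ℝ), IsMonotoneCurve (initialCurve f ε ∩ U)) :
    ∃ ε₀ : ℝ, 0 < ε₀ ∧ ∀ ε : ℝ, 0 < ε → ε < ε₀ →
      ∀ (L : Set ℝ) (A B T : ℝ → ℝ) (x y ap bp am bm : ℝ → ℝ → ℝ),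
        (∀ l ∈ L, (A l, B l) ∈ initialCurve f ε) →
        (∀ p ∈ initialCurve f ε ∩ U, ∃ l ∈ L, (A l, B l) = p) →
        IsShockFront (fun _ _ => 1) (potential f ε) (plusSide f ε) (minusSide f ε)
          L A B T x y ap bp am bm →
        ∃ l₀ ∈ L, (A l₀, B l₀) ∈ U ∧
          (∀ K : Set (ℝ × ℝ), Bornology.IsBounded K →
            ∃ᶠ p in 𝓝[>] (0 : ℝ) ×ˢ 𝓝 l₀, p ∈ frontDomain L T ∧
              (p.1, x p.1 p.2, y p.1 p.2) ∉
                variationalSurface (potential f ε) (plusSide f ε) (minusSide f ε) K) ∧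
          (∃ᶠ p in 𝓝[>] (0 : ℝ) ×ˢ 𝓝 l₀, p ∈ frontDomain L T ∧
              (p.1, x p.1 p.2, y p.1 p.2) ∉ hopfLaxSingularSet (potential f ε)) := by
  obtain ⟨a, haU, hfaa⟩ := hfaa
  obtain ⟨ε₀, hε₀, hcurved⟩ := exists_curved_point hf hU haU hfaa
  refine ⟨ε₀, hε₀, fun ε hε hεε₀ L A B T x y ap bp am bm hcurve hcover h => ?_⟩
  obtain ⟨b, hbU, hbc, hgrad, hcurv⟩ := hcurved ε hε hεε₀
  obtain ⟨l₀, hl₀, hAB⟩ := hcover (a, b) ⟨hbc, hbU⟩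
  rw [← hAB] at hgrad hcurv hbU
  have hdom := eventually_mem_frontDomain h.isOpen_param h.lifetime_lsc hl₀ (h.lifetime_pos l₀ hl₀)
  have hfst : Tendsto Prod.fst (𝓝[>] (0 : ℝ) ×ˢ 𝓝 l₀) (𝓝[>] (0 : ℝ)) := tendsto_fst
  have hne : (𝓝[>] (0 : ℝ) ×ˢ 𝓝 l₀).NeBot := inferInstance
  have hbdd : ∀ {φ : ℝ → ℝ → ℝ}, ContDiffOn ℝ 1 (Function.uncurry φ) (frontDomain L T) →
      ∃ R, ∀ᶠ p in 𝓝[>] (0 : ℝ) ×ˢ 𝓝 l₀, |φ p.1 p.2| ≤ R := by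
    intro φ hφ
    have hc := (hφ.continuousOn (0, l₀) ⟨hl₀, le_rfl, h.lifetime_pos l₀ hl₀⟩).mono_left
      (tendsto_prod_nhdsWithin_frontDomain h.isOpen_param h.lifetime_lsc hl₀
        (h.lifetime_pos l₀ hl₀))
    refine ⟨|φ 0 l₀| + 1, ?_⟩
    filter_upwards [hc.abs.eventually_lt_const (lt_add_one _)] with p hp
    exact hp.le
  have main : ∀ K : Set (ℝ × ℝ), Bornology.IsBounded K →
      ¬ ∀ᶠ p in 𝓝[>] (0 : ℝ) ×ˢ 𝓝 l₀, (p.1, x p.1 p.2, y p.1 p.2) ∈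
        variationalSurface (potential f ε) (plusSide f ε) (minusSide f ε) K := by
    intro K hK hev
    refine h.not_eventually_potential_continuous hf hcurve hl₀ hgrad hcurv ?_
    obtain ⟨R₁, hR₁⟩ := hbdd h.contDiff_ap
    obtain ⟨R₂, hR₂⟩ := hbdd h.contDiff_bp
    -- The box contains the plus feet of the front near `(0, l₀)`; enlarging `K` by it lets
    -- injectivity compare them with the feet of the variational surface.
    have hK' : Bornology.IsBounded (K ∪ Icc (-R₁) R₁ ×ˢ Icc (-R₂) R₂) :=
      hK.union (isCompact_Icc.prod isCompact_Icc).isBounded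
    filter_upwards [hfst.eventually (eventually_variationalSurface_imp (ε := ε) hf hK'), hdom, hev,
      hR₁, hR₂] with p hp hpd hpv h1 h2
    obtain ⟨-, -, e1, e2⟩ := h.plus_eq hf hpd.1.1 hpd.2 hpd.1.2.2
    exact hp _ _ _ _ (Or.inr ⟨abs_le.1 h1, abs_le.1 h2⟩) e1 e2
      (variationalSurface_mono subset_union_left hpv)
  have hfreq : ∀ S : Set (ℝ × ℝ × ℝ),
      (¬ ∀ᶠ p in 𝓝[>] (0 : ℝ) ×ˢ 𝓝 l₀, (p.1, x p.1 p.2, y p.1 p.2) ∈ S) →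
      ∃ᶠ p in 𝓝[>] (0 : ℝ) ×ˢ 𝓝 l₀, p ∈ frontDomain L T ∧
        (p.1, x p.1 p.2, y p.1 p.2) ∉ S := fun S hS =>
    ((not_eventually.1 hS).and_eventually hdom).mono fun p hp => ⟨hp.2.1, hp.1⟩
  refine ⟨l₀, hl₀, hbU, fun K hK => hfreq _ (main K hK), hfreq _ fun hev => ?_⟩
  -- The assumption to be refuted itself supplies the singular point needed to confine the
  -- minimizers.
  obtain ⟨p₁, hp₁⟩ := hev.exists
  obtain ⟨R₁, hR₁⟩ := hbdd h.contDiff_x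
  obtain ⟨R₂, hR₂⟩ := hbdd h.contDiff_y
  obtain ⟨K, hK, hKev⟩ := exists_isBounded_hopfLaxSingularSet_imp hf hp₁ (max R₁ R₂)
  refine main K hK ?_
  filter_upwards [hfst.eventually hKev, hdom, hev, hR₁, hR₂] with p hp hpd hpv h1 h2
  obtain ⟨-, -, e1, e2⟩ := h.minus_eq hf hpd.1.1 hpd.2 hpd.1.2.2
  exact hp _ _ (h1.trans (le_max_left _ _)) (h2.trans (le_max_right _ _))
    (e1 ▸ e2 ▸ h.mem_minus p.2 hpd.1.1 p.1 hpd.2 hpd.1.2.2) hpv
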